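/- Let $k$ be an arbitrary field and let $\mathfrak{g}$ be a finite-dimensional Lie algebra over $k$ with lower central series $\mathfrak{g}^1=\mathfrak{g}$, $\mathfrak{g}^{i+1}=[\mathfrak{g},\mathfrak{g}^i]$. Suppose that $\mathfrak{g}$ is $2$-step nilpotent, i.e. $\mathfrak{g}^2\neq 0$ and $\mathfrak{g}^3=0$, and that it is of type $(n_1,n_2)$, i.e. $n_1=\dim_k(\mathfrak{g}^1/\mathfrak{g}^2)$ and $n_2=\dim_k(\mathfrak{g}^2/\mathfrak{g}^3)$. Let $b_2(\mathfrak{g})=\dim_k \mathrm{H}^2(\mathfrak{g},k)$ be the second Betti number, where $\mathrm{H}^2(\mathfrak{g},k)$ is the second Chevalley–Eilenberg cohomology of $\mathfrak{g}$ with coefficients in the trivial module $k$. Then \[ \binom{n_1}{2}-n_2+\max\Big\{0,\ 2\binom{n_1+1}{3}-n_1\binom{n_1}{2}+n_1n_2\Big\}\ \leq\ b_2(\mathfrak{g})\ \leq\ \binom{n_1}{2}+n_2(n_1-1). \] -/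

import Mathlib

section

set_option maxSynthPendingDepth 3

variable (k : Type*) [Field k] (g : Type*) [LieRing g] [LieAlgebra k g]

/-- The term `g^i` of the lower central series, indexed from one: `g^1 = g` and
`g^(i+1) = [g, g^i]`. (Mathlib indexes from zero; the value at `i = 0` is not used.) -/
def lcsTerm (i : ℕ) : LieIdeal k g :=
  LieModule.lowerCentralSeries k g g (i - 1)

/-- For `p ≥ 1`, the Lie algebra `g` is `p`-step nilpotent if `g^p ≠ 0` and `g^(p+1) = 0`. -/
def IsStepNilpotent (p : ℕ) : Prop :=
  1 ≤ p ∧ lcsTerm k g p ≠ ⊥ ∧ lcsTerm k g (p + 1) = ⊥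

/-- The dimension of `g^i / g^(i+1)`. -/
noncomputable def typeNumber (i : ℕ) : ℕ :=
  Module.finrank k
    ((lcsTerm k g i).toSubmodule ⧸
      (lcsTerm k g (i + 1)).toSubmodule.submoduleOf (lcsTerm k g i).toSubmodule)

/-- `g` is a `p`-step nilpotent Lie algebra of type `(n 0, …, n (p - 1))`: the `i`-th entry of the
type, counted from one, is the dimension of `g^i / g^(i+1)`. -/
def HasType {p : ℕ} (n : Fin p → ℕ) : Prop :=
  IsStepNilpotent k g p ∧ ∀ i : Fin p, n i = typeNumber k g (i + 1)

open LieModule.Cohomology in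
/-- The second Chevalley–Eilenberg cohomology `ker d² / im d¹` of `g` with coefficients in `M`.
Mathlib's 2-cochains are the bilinear maps `c` with `c x x = 0`, that is, `Hom_k(Λ² g, M)`. -/
abbrev LieH2 (M : Type*) [AddCommGroup M] [Module k M] [LieRingModule g M] [LieModule k g M] :
    Type _ :=
  twoCocycle k g M ⧸ (LinearMap.range (d₁₂ k g M)).submoduleOf (twoCocycle k g M)

/-- The second Betti number `b₂(g) = dim H²(g, k)`, with `k` the trivial `g`-module. -/
noncomputable def secondBetti : ℕ :=
  Module.finrank k (LieH2 k g (TrivialLieModule k g k))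

end

set_option maxSynthPendingDepth 3

open LieModule.Cohomology Module

/-! Write `g = V ⊕ z` with `z = g²`, which is central. A 2-cocycle must vanish on `z × z`, so it
amounts to an alternating form on `V` and a pairing `φ : V → z → k`; the cocycle identity constrains
only `φ`, asking that its cyclic sum in `Λ³V*` vanish. Coboundaries form a copy of `z*`. Hence `b₂ =
C(n₁,2) - n₂ + dim ker (cyclicSum)`. The map `cyclicSum` goes from a space of dimension `n₁n₂` to
one of dimension `C(n₁,3)`, so rank-nullity bounds its kernel on both sides. -/

section AlternatingMap

variable {k V N : Type*} [Field k] [AddCommGroup V] [Module k V] [AddCommGroup N] [Module k N]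

/-- A bilinear map vanishing on the diagonal, as an alternating map in two arguments. -/
def alternatingMapOfBilin (B : V →ₗ[k] V →ₗ[k] N) (hB : ∀ x, B x x = 0) : V [⋀^Fin 2]→ₗ[k] N where
  toFun v := B (v 0) (v 1)
  map_update_add' v i x y := by fin_cases i <;> simp
  map_update_smul' v i c x := by fin_cases i <;> simp
  map_eq_zero_of_eq' v i j h hij := by
    fin_cases i <;> fin_cases j <;> simp_all

@[simp]
lemma alternatingMapOfBilin_apply (B : V →ₗ[k] V →ₗ[k] N) (hB : ∀ x, B x x = 0) (v : Fin 2 → V) :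
    alternatingMapOfBilin B hB v = B (v 0) (v 1) := rfl

/-- An alternating map in two arguments, as a bilinear map. -/
def AlternatingMap.toBilin (ω : V [⋀^Fin 2]→ₗ[k] N) : V →ₗ[k] V →ₗ[k] N :=
  LinearMap.mk₂ k (fun x y => ω ![x, y])
    (fun x x' y => by simpa using ω.map_vecCons_add ![y] x x')
    (fun c x y => by simpa using ω.map_vecCons_smul ![y] c x)
    (fun x y y' => by simpa using (ω.curryLeft x).map_vecCons_add ![] y y')
    (fun c x y => by simpa using (ω.curryLeft x).map_vecCons_smul ![] c y)

@[simp]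
lemma AlternatingMap.toBilin_apply (ω : V [⋀^Fin 2]→ₗ[k] N) (x y : V) :
    ω.toBilin x y = ω ![x, y] := rfl

lemma AlternatingMap.map_pair_self (ω : V [⋀^Fin 2]→ₗ[k] N) (x : V) : ω ![x, x] = 0 :=
  ω.map_eq_zero_of_eq ![x, x] (i := 0) (j := 1) rfl (by decide)

instance AlternatingMap.finite_fin [FiniteDimensional k V] [FiniteDimensional k N] (n : ℕ) :
    FiniteDimensional k (V [⋀^Fin n]→ₗ[k] N) :=
  Module.Finite.equiv (exteriorPower.alternatingMapLinearEquiv (R := k) (M := V) (N := N)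
    (n := n)).symm

lemma AlternatingMap.finrank_fin [FiniteDimensional k V] [FiniteDimensional k N] (n : ℕ) :
    finrank k (V [⋀^Fin n]→ₗ[k] N) = (finrank k V).choose n * finrank k N := by
  rw [LinearEquiv.finrank_eq (exteriorPower.alternatingMapLinearEquiv (R := k) (M := V) (N := N)
    (n := n)), finrank_linearMap, exteriorPower.finrank_eq]

end AlternatingMap

/-! ### Cocycles and coboundaries in terms of a complement of the derived algebra -/

section TwoStep

variable {k g M : Type*} [Field k] [LieRing g] [LieAlgebra k g] [AddCommGroup M] [Module k M]
  {V z : Submodule k g} (h : IsCompl V z)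

/-- The bracket on a complement `V` of `z`, projected to `z`. -/
noncomputable def bracketOnCompl : V [⋀^Fin 2]→ₗ[k] z :=
  alternatingMapOfBilin
    (LinearMap.mk₂ k (fun x y : V => z.projectionOnto V h.symm ⁅(x : g), (y : g)⁆)
      (by simp) (by simp) (by simp) (by simp)) (by simp)

@[simp]
lemma bracketOnCompl_apply (v : Fin 2 → V) :
    bracketOnCompl h v = z.projectionOnto V h.symm ⁅(v 0 : g), (v 1 : g)⁆ := rfl

variable (M) in
/-- The map sending a pairing `φ : V → z → M` to the alternating sum of `φ x [y, w]` over cyclic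
rearrangements of `x, y, w`. -/
noncomputable def cyclicSum : (V →ₗ[k] z →ₗ[k] M) →ₗ[k] V [⋀^Fin 3]→ₗ[k] M where
  toFun φ := AlternatingMap.alternatizeUncurryFin
    { toFun := fun x => (φ x).compAlternatingMap (bracketOnCompl h)
      map_add' := fun x y => by ext; simp
      map_smul' := fun c x => by ext; simp }
  map_add' φ ψ := by
    rw [← AlternatingMap.alternatizeUncurryFin_add]; congr 1
  map_smul' c φ := by
    rw [RingHom.id_apply, ← AlternatingMap.alternatizeUncurryFin_smul]; congr 1

lemma cyclicSum_apply (φ : V →ₗ[k] z →ₗ[k] M) (v : Fin 3 → V) :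
    cyclicSum M h φ v = φ (v 0) (z.projectionOnto V h.symm ⁅(v 1 : g), (v 2 : g)⁆)
      - φ (v 1) (z.projectionOnto V h.symm ⁅(v 0 : g), (v 2 : g)⁆)
      + φ (v 2) (z.projectionOnto V h.symm ⁅(v 0 : g), (v 1 : g)⁆) := by
  simp [cyclicSum, AlternatingMap.alternatizeUncurryFin_apply, Fin.sum_univ_three, Fin.removeNth,
    Fin.succAbove, sub_eq_add_neg]

variable (M) in
/-- The two-cochain on `g = V ⊕ z` with components `ω` on `V × V`, `φ` on `V × z` and zero on
`z × z`. -/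
noncomputable def cochainOfCompl :
    (V [⋀^Fin 2]→ₗ[k] M) × (V →ₗ[k] z →ₗ[k] M) →ₗ[k] twoCochain k g M where
  toFun p :=
    ⟨p.1.toBilin.compl₁₂ (V.projectionOnto z h) (V.projectionOnto z h)
      + p.2.compl₁₂ (V.projectionOnto z h) (z.projectionOnto V h.symm)
      - (p.2.compl₁₂ (V.projectionOnto z h) (z.projectionOnto V h.symm)).flip,
      fun x => by simp [AlternatingMap.map_pair_self]⟩
  map_add' p q := by
    ext x y
    simp
    abel
  map_smul' c p := by
    ext x y
    simp [smul_sub]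

lemma cochainOfCompl_apply (p : (V [⋀^Fin 2]→ₗ[k] M) × (V →ₗ[k] z →ₗ[k] M)) (x y : g) :
    cochainOfCompl M h p x y = p.1 ![V.projectionOnto z h x, V.projectionOnto z h y]
      + p.2 (V.projectionOnto z h x) (z.projectionOnto V h.symm y)
      - p.2 (V.projectionOnto z h y) (z.projectionOnto V h.symm x) := rfl

lemma cochainOfCompl_injective : Function.Injective (cochainOfCompl M h) := by
  rw [injective_iff_map_eq_zero]
  intro p hp
  have h0 (x y : g) : cochainOfCompl M h p x y = 0 := by rw [hp]; rfl
  refine Prod.ext ?_ ?_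
  · ext v
    have := h0 (v 0) (v 1)
    rw [cochainOfCompl_apply] at this
    simp only [Submodule.projectionOnto_apply_left, Submodule.projectionOnto_apply_right, map_zero,
      add_zero, sub_zero] at this
    rw [show v = ![v 0, v 1] by ext i; fin_cases i <;> rfl]
    exact this
  · ext x y
    have := h0 x y
    rw [cochainOfCompl_apply] at this
    have h1 : p.1 ![x, 0] = 0 := p.1.map_coord_zero (m := ![x, 0]) 1 rfl
    simpa [h1] using this

variable [LieRingModule g M] [LieModule k g M]

lemma finrank_lieH2_add [FiniteDimensional k g] [FiniteDimensional k M] :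
    finrank k (LieH2 k g M) + finrank k (LinearMap.range (d₁₂ k g M)) =
      finrank k (twoCocycle k g M) := by
  have hle : LinearMap.range (d₁₂ k g M) ≤ twoCocycle k g M := by
    rw [twoCocycle, LinearMap.range_le_ker_iff]
    exact d₂₃_comp_d₁₂ k g M
  rw [← (Submodule.submoduleOfEquivOfLe hle).finrank_eq]
  exact Submodule.finrank_quotient_add_finrank _

variable [LieModule.IsTrivial g M]

lemma cochainOfCompl_mem_twoCocycle_iff (hmem : ∀ x y : g, ⁅x, y⁆ ∈ z)
    (hcen : ∀ x : g, ∀ y ∈ z, ⁅x, y⁆ = 0)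
    (p : (V [⋀^Fin 2]→ₗ[k] M) × (V →ₗ[k] z →ₗ[k] M)) :
    cochainOfCompl M h p ∈ twoCocycle k g M ↔ cyclicSum M h p.2 = 0 := by
  have hV (x y : g) : V.projectionOnto z h ⁅x, y⁆ = 0 :=
    (Submodule.projectionOnto_apply_eq_zero_iff h).2 (hmem x y)
  -- As `z` is central, a bracket depends only on the `V`-components of its arguments.
  have hl (x y : g) :
      ⁅(V.projectionOnto z h x : g), (V.projectionOnto z h y : g)⁆ = ⁅x, y⁆ := by
    have key (x : g) : (V.projectionOnto z h x : g) = x - z.projectionOnto V h.symm x :=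
      eq_sub_of_add_eq (Submodule.projection_add_projection_eq_self h x)
    have h2 (x y : g) : ⁅(z.projectionOnto V h.symm x : g), y⁆ = 0 := by
      rw [← lie_skew, hcen _ _ (Subtype.property _), neg_zero]
    rw [key x, key y, lie_sub, hcen _ _ (Subtype.property _), sub_zero, sub_lie, h2, sub_zero]
  have h1 (x : V) : p.1 ![x, 0] = 0 := p.1.map_coord_zero (m := ![x, 0]) 1 rfl
  have h1' (x : V) : p.1 ![0, x] = 0 := p.1.map_coord_zero (m := ![0, x]) 0 rfl
  rw [mem_twoCocycle_iff_of_trivial]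
  constructor
  · intro H
    ext v
    have := H (v 0) (v 1) (v 2)
    simp only [cochainOfCompl_apply, hV, h1, h1', map_zero, LinearMap.zero_apply, zero_add,
      sub_zero, zero_sub, Submodule.projectionOnto_apply_left] at this
    rw [cyclicSum_apply, this, AlternatingMap.zero_apply]
    abel
  · intro H x y w
    have := congrArg (fun f => f ![V.projectionOnto z h x, V.projectionOnto z h y,
      V.projectionOnto z h w]) H
    simp only [cyclicSum_apply, Matrix.cons_val, hl, AlternatingMap.zero_apply] at this
    simp only [cochainOfCompl_apply, hV, h1, h1', map_zero, LinearMap.zero_apply, zero_add,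
      sub_zero, zero_sub]
    rw [← sub_eq_zero, ← this]
    abel

/-- The only component missing from `cochainOfCompl` is the one on `z × z`, and cocycles have none:
for central `x`, the cocycle identity turns `c x ⁅a, b⁆` into terms containing `⁅x, a⁆` or `⁅x, b⁆`,
and such brackets `⁅a, b⁆` span `z`. -/
lemma exists_cochainOfCompl_eq (hcen : ∀ x : g, ∀ y ∈ z, ⁅x, y⁆ = 0)
    (hspan : z = Submodule.span k {w | ∃ x y : g, ⁅x, y⁆ = w})
    (c : twoCochain k g M) (hc : c ∈ twoCocycle k g M) : ∃ p, cochainOfCompl M h p = c := by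
  have hzz (x y : g) (hx : x ∈ z) (hy : y ∈ z) : c x y = 0 := by
    rw [hspan] at hy
    induction hy using Submodule.span_induction with
    | mem w hw =>
      obtain ⟨a, b, rfl⟩ := hw
      rw [(mem_twoCocycle_iff_of_trivial k g M c).1 hc, ← lie_skew x a, ← lie_skew x b,
        hcen _ _ hx, hcen _ _ hx]
      simp
    | zero => simp
    | add a b _ _ ha hb => simp [ha, hb]
    | smul t a _ ha => simp [ha]
  refine ⟨(alternatingMapOfBilin (c.1.compl₁₂ V.subtype V.subtype) (fun x => c.2 x),
    c.1.compl₁₂ V.subtype z.subtype), ?_⟩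
  ext x y
  simp only [twoCochain_val_apply, cochainOfCompl_apply]
  conv_rhs => rw [← Submodule.projection_add_projection_eq_self h x,
    ← Submodule.projection_add_projection_eq_self h y]
  have hz := hzz _ _ (Submodule.projection_apply_mem h.symm x)
    (Submodule.projection_apply_mem h.symm y)
  have hs := twoCochain_skew c (V.projection z h y) (z.projection V h.symm x)
  simp only [map_add, LinearMap.add_apply, hz, ← hs]
  change c (V.projection z h x) (V.projection z h y) + c (V.projection z h x) (z.projection V h.symm y)
    - c (V.projection z h y) (z.projection V h.symm x) = _
  abel

lemma finrank_twoCocycle_of_isCompl [FiniteDimensional k g] [FiniteDimensional k M]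
    (hcen : ∀ x : g, ∀ y ∈ z, ⁅x, y⁆ = 0)
    (hspan : z = Submodule.span k {w | ∃ x y : g, ⁅x, y⁆ = w}) :
    finrank k (twoCocycle k g M) =
      (finrank k V).choose 2 * finrank k M + finrank k (LinearMap.ker (cyclicSum M h)) := by
  have hmem (x y : g) : ⁅x, y⁆ ∈ z := by
    rw [hspan]; exact Submodule.subset_span ⟨x, y, rfl⟩
  let Ψ := cochainOfCompl M h ∘ₗ
    LinearMap.prodMap LinearMap.id (LinearMap.ker (cyclicSum M h)).subtype
  have hΨ : Function.Injective Ψ := by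
    refine (cochainOfCompl_injective h).comp ?_
    rintro ⟨a, b⟩ ⟨a', b'⟩ hab
    simpa [Prod.ext_iff] using hab
  have hr : LinearMap.range Ψ = twoCocycle k g M := by
    apply le_antisymm
    · rintro _ ⟨⟨ω, φ⟩, rfl⟩
      exact (cochainOfCompl_mem_twoCocycle_iff h hmem hcen _).2 φ.2
    · intro c hc
      obtain ⟨p, rfl⟩ := exists_cochainOfCompl_eq h hcen hspan c hc
      exact ⟨(p.1, ⟨p.2, (cochainOfCompl_mem_twoCocycle_iff h hmem hcen p).1 hc⟩), rfl⟩
  rw [← hr, LinearMap.finrank_range_of_inj hΨ, finrank_prod, AlternatingMap.finrank_fin]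

/-- Up to sign `d₁₂ f` is `f ⁅x, y⁆`, so `d₁₂` has the same kernel as restriction of `f` to `z`,
which is onto `z →ₗ[k] M`. -/
lemma finrank_range_d₁₂ [FiniteDimensional k g] [FiniteDimensional k M]
    (hspan : z = Submodule.span k {w | ∃ x y : g, ⁅x, y⁆ = w}) :
    finrank k (LinearMap.range (d₁₂ k g M)) = finrank k z * finrank k M := by
  let res : (g →ₗ[k] M) →ₗ[k] (z →ₗ[k] M) := LinearMap.lcomp k M z.subtype
  have hres : LinearMap.range res = ⊤ := by
    rw [LinearMap.range_eq_top]
    intro f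
    exact f.exists_extend
  have hker : LinearMap.ker res = LinearMap.ker (d₁₂ k g M) := by
    ext f
    rw [LinearMap.mem_ker, LinearMap.mem_ker]
    constructor
    · intro hf
      ext x y
      have hxy : ⁅x, y⁆ ∈ z := by rw [hspan]; exact Submodule.subset_span ⟨x, y, rfl⟩
      have := LinearMap.congr_fun hf ⟨_, hxy⟩
      have h' : f ⁅x, y⁆ = 0 := this
      rw [twoCochain_val_apply, d₁₂_apply_apply_ofTrivial, h', neg_zero]
      rfl
    · intro hf
      ext ⟨w, hw⟩
      change f w = 0
      have hle : z ≤ LinearMap.ker f := by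
        rw [hspan, Submodule.span_le]
        rintro _ ⟨x, y, rfl⟩
        have : d₁₂ k g M f x y = 0 := by rw [hf]; rfl
        rwa [d₁₂_apply_apply_ofTrivial, neg_eq_zero] at this
      exact hle hw
  have e1 := res.finrank_range_add_finrank_ker
  have e2 := (d₁₂ k g M).finrank_range_add_finrank_ker
  rw [hres, finrank_top, hker] at e1
  rw [← finrank_linearMap k k z M]
  exact Nat.add_right_cancel (e2.trans e1.symm)

end TwoStep

/-! ### Numerical identities and the bounds -/

lemma two_mul_choose_three_sub (n : ℕ) :
    2 * ((n + 1).choose 3 : ℤ) - n * (n.choose 2 : ℤ) = -(n.choose 3 : ℤ) := by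
  induction n with
  | zero => simp [Nat.choose]
  | succ n ih =>
    have h1 := Nat.choose_succ_succ (n + 1) 2
    have h2 := Nat.choose_succ_succ n 2
    have h3 := Nat.choose_succ_succ n 1
    have h4 : 2 * (n.choose 2 : ℤ) = n * (n - 1) := by
      cases n with
      | zero => simp
      | succ m =>
        have : (m + 1) * m % 2 = 0 := by
          rw [mul_comm]; exact Nat.even_iff.1 (Nat.even_mul_succ_self m)
        have h6 : 2 * (m + 1).choose 2 = (m + 1) * m := by
          rw [Nat.choose_two_right]; simp; omega
        push_cast
        rw [add_sub_cancel_right]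
        exact_mod_cast h6
    simp only [Nat.succ_eq_add_one, Nat.reduceAdd, Nat.choose_one_right] at h1 h2 h3
    rw [h1]
    rw [h2] at ih ⊢
    rw [h3]
    push_cast at ih ⊢
    linarith

lemma typeNumber_add_finrank (k g : Type*) [Field k] [LieRing g] [LieAlgebra k g]
    [FiniteDimensional k g] (i : ℕ) :
    typeNumber k g i + finrank k (lcsTerm k g (i + 1)) = finrank k (lcsTerm k g i) := by
  have hle : (lcsTerm k g (i + 1)).toSubmodule ≤ (lcsTerm k g i).toSubmodule :=
    LieModule.antitone_lowerCentralSeries k g g (by omega)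
  have := Submodule.finrank_quotient_add_finrank
    ((lcsTerm k g (i + 1)).toSubmodule.submoduleOf (lcsTerm k g i).toSubmodule)
  rwa [(Submodule.submoduleOfEquivOfLe hle).finrank_eq] at this

theorem corollary4p7 (k : Type*) [Field k] (g : Type*) [LieRing g] [LieAlgebra k g]
    [FiniteDimensional k g] (n₁ n₂ : ℕ) (hg : HasType k g ![n₁, n₂]) :
    (n₁.choose 2 : ℤ) - n₂ +
        max 0 (2 * ((n₁ + 1).choose 3 : ℤ) - n₁ * (n₁.choose 2 : ℤ) + n₁ * n₂) ≤
      (secondBetti k g : ℤ) ∧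
    (secondBetti k g : ℤ) ≤ (n₁.choose 2 : ℤ) + n₂ * ((n₁ : ℤ) - 1) := by
  obtain ⟨⟨-, -, h3⟩, ht⟩ := hg
  set z : Submodule k g := (lcsTerm k g 2).toSubmodule with hzdef
  have hspan : z = Submodule.span k {w | ∃ x y : g, ⁅x, y⁆ = w} := by
    rw [hzdef]
    simp [lcsTerm, LieModule.lowerCentralSeries_succ, LieSubmodule.lieIdeal_oper_eq_linear_span']
  have hcen (x y : g) (hy : y ∈ z) : ⁅x, y⁆ = 0 := by
    have : ⁅x, y⁆ ∈ lcsTerm k g 3 := by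
      simp only [lcsTerm, Nat.add_one_sub_one, LieModule.lowerCentralSeries_succ k g g 1]
      exact LieSubmodule.lie_mem_lie (LieSubmodule.mem_top x) hy
    rw [h3] at this
    simpa using this
  obtain ⟨V, hV⟩ := z.exists_isCompl
  have e1 : n₁ + finrank k z = finrank k g := by
    have := typeNumber_add_finrank k g 1
    rw [show typeNumber k g 1 = n₁ from (ht 0).symm] at this
    exact this.trans (finrank_top k g)
  have e2 : n₂ = finrank k z := by
    have := typeNumber_add_finrank k g 2
    rw [show typeNumber k g 2 = n₂ from (ht 1).symm, h3] at this
    have hbot : finrank k (⊥ : LieIdeal k g) = 0 := finrank_bot k g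
    rwa [hbot, add_zero] at this
  have e3 : finrank k V = n₁ := by
    have := Submodule.finrank_add_eq_of_isCompl hV
    omega
  let M := TrivialLieModule k g k
  have hfin : FiniteDimensional k M := inferInstanceAs (FiniteDimensional k k)
  have hM : finrank k M = 1 := finrank_self k
  have f1 := finrank_lieH2_add (k := k) (g := g) (M := M)
  rw [finrank_range_d₁₂ hspan, finrank_twoCocycle_of_isCompl hV.symm hcen hspan, hM, e3, ← e2,
    mul_one, mul_one] at f1
  have f2 := (cyclicSum M hV.symm).finrank_range_add_finrank_ker
  -- The rank of `cyclicSum` is at most `dim Λ³V* = C(n₁,3)`.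
  have f3 := (LinearMap.range (cyclicSum M hV.symm)).finrank_le
  rw [AlternatingMap.finrank_fin, hM, e3, mul_one] at f3
  rw [finrank_linearMap, finrank_linearMap, hM, e3, ← e2, mul_one] at f2
  rw [two_mul_choose_three_sub]
  change finrank k (LieH2 k g M) + _ = _ at f1
  have hb : secondBetti k g = finrank k (LieH2 k g M) := rfl
  rw [hb]
  zify at f1 f2 f3
  constructor
  -- The two entries of the maximum are the bounds `0` and `n₁n₂ - C(n₁,3)` for the dimension of the
  -- kernel.
  · rw [← le_sub_iff_add_le', max_le_iff]
    constructor <;> linarith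
  -- Here the kernel has dimension at most `n₁n₂`.
  · linarith
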